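/- Definitions. An o-minimal structure on $(\mathbb R,+,\cdot)$ is a sequence $\mathcal O=(\mathcal O_n)_{n\ge 0}$, where $\mathcal O_n$ is a Boolean algebra of subsets of $\mathbb R^n$, such that for every $n$: (i) $A\in\mathcal O_n$ implies $A\times\mathbb R,\ \mathbb R\times A\in\mathcal O_{n+1}$; (ii) if $\Pi:\mathbb R^{n+1}\to\mathbb R^n$ is the projection onto the first $n$ coordinates and $A\in\mathcal O_{n+1}$, then $\Pi(A)\in\mathcal O_n$; (iii) $\{x\in\mathbb R^n: p(x)=0\}\in\mathcal O_n$ for every real polynomial $p$ in $n$ variables; (iv) $\mathcal O_1$ consists exactly of the finite unions of intervals and points. A function $f:\mathbb R^n\to\mathbb R$ is definable in $\mathcal O$ if its graph belongs to $\mathcal O_{n+1}$. A function $f:\mathbb R^n\to\mathbb R$ is tame if for every $r>0$ there is an o-minimal structure $\mathcal O$ such that the intersection of the graph of $f$ with $[-r,r]^{n+1}$ belongs to $\mathcal O_{n+1}$. The directional derivative is $f'(x;l)=\lim_{t\downarrow 0}\frac{f(x+tl)-f(x)}{t}$. For every $n\ge 2$ and every unit vector $l\in S_{n-1}\subset\mathbb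 R^n$ fix a rotation $R_{n,l}$ of $\mathbb R^n$ with $R_{n,l}(l)=e^n$, and let $\Pi^{\rm T}_{n-1,l}:\mathbb R^{n-1}\to \{l\}^\perp$ be given by $\Pi^{\rm T}_{n-1,l}(y)=R_{n,l}^{-1}(y,0)$. For $M\ge 0$, a function $f:\mathbb R\to\mathbb R$ is $M$-directed subdifferentiable at $x$ if $f'(x;-1)$ and $f'(x;1)$ exist and $\max\{|f'(x;-1)|,|f'(x;1)|\}\le M$. For $n\ge 2$, a function $f:\mathbb R^n\to\mathbb R$ is $M$-directed subdifferentiable at $x$ if $f'(x;l)$ exists for every $l\in\mathbb R^n$, is continuous in $l$, satisfies $|f'(x;l)|\le M$ for all $l\in S_{n-1}$, and for every $l\in S_{n-1}$ the function $f_l:\mathbb R^{n-1}\to\mathbb R$, $f_l(y)=f'(x;l+\Pi^{\rm T}_{n-1,l}(y))$, is $M$-directed subdifferentiable at $0$. A function is directed subdifferentiable at $x$ if it is $M$-directed subdifferentiable at $x$ for some $M\ge 0$. Statement. (1) Let $f:\mathbb R^n\to\mathbb R$ be Lipschitz on a neighbourhood of $x\in\mathbb R^n$ and definable in an o-minimal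 structure $\mathcal O$. Then the directional derivative $f'(x;l)$ exists for every $l\in\mathbb R^n$, and the function $f'(x;\cdot):\mathbb R^n\to\mathbb R$ is globally Lipschitz and definable in $\mathcal O$. (2) Let $n\ge 1$, let the rotations $R_{m,l}$ ($m\ge 2$, $l\in S_{m-1}$) be chosen arbitrarily, and let $f:\mathbb R^n\to\mathbb R$ be definable in some o-minimal structure, or tame. If $f$ is Lipschitz on a neighbourhood of $x\in\mathbb R^n$, then $f$ is directed subdifferentiable at $x$. If $f$ is globally Lipschitz, then there is one $M\ge 0$ such that $f$ is $M$-directed subdifferentiable at every $x\in\mathbb R^n$. -/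

import Mathlib

open Filter Topology
open scoped NNReal

namespace DirSub

/-- Euclidean space `ℝⁿ`. -/
abbrev E (n : ℕ) : Type := EuclideanSpace ℝ (Fin n)

/-- An o-minimal structure on `(ℝ, +, ·)`: Boolean algebras `sets n` of (definable) subsets of `ℝⁿ`.
An interval of `ℝ` (bounded or not, open or not, possibly a single point) is an order-connected
set. -/
structure OMinimalStructure where
  sets : (n : ℕ) → Set (Set (Fin n → ℝ))
  empty_mem : ∀ n, (∅ : Set (Fin n → ℝ)) ∈ sets n
  compl_mem : ∀ n (A : Set (Fin n → ℝ)), A ∈ sets n → Aᶜ ∈ sets n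
  union_mem : ∀ n (A B : Set (Fin n → ℝ)), A ∈ sets n → B ∈ sets n → A ∪ B ∈ sets n
  /-- the set `A × ℝ` -/
  prod_univ_mem : ∀ n (A : Set (Fin n → ℝ)), A ∈ sets n →
    {x : Fin (n + 1) → ℝ | (fun i : Fin n => x i.castSucc) ∈ A} ∈ sets (n + 1)
  /-- the set `ℝ × A` -/
  univ_prod_mem : ∀ n (A : Set (Fin n → ℝ)), A ∈ sets n →
    {x : Fin (n + 1) → ℝ | (fun i : Fin n => x i.succ) ∈ A} ∈ sets (n + 1)
  /-- the projection onto the first `n` coordinates -/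
  proj_mem : ∀ n (A : Set (Fin (n + 1) → ℝ)), A ∈ sets (n + 1) →
    (fun (x : Fin (n + 1) → ℝ) (i : Fin n) => x i.castSucc) '' A ∈ sets n
  algebraic_mem : ∀ n (p : MvPolynomial (Fin n) ℝ), {x | MvPolynomial.eval x p = 0} ∈ sets n
  mem_one_iff : ∀ A : Set (Fin 1 → ℝ), A ∈ sets 1 ↔
    ∃ S : Set (Set ℝ), S.Finite ∧ (∀ I ∈ S, I.OrdConnected) ∧ A = {x | x 0 ∈ ⋃₀ S}

/-- The graph of `f : ℝⁿ → ℝ` as a subset of `ℝⁿ⁺¹`. -/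
def graph {n : ℕ} (f : E n → ℝ) : Set (Fin (n + 1) → ℝ) :=
  {z | f (WithLp.toLp 2 (fun i : Fin n => z i.castSucc)) = z (Fin.last n)}

/-- `f` is definable in the o-minimal structure `O`. -/
def OMinimalStructure.DefinableFun (O : OMinimalStructure) {n : ℕ} (f : E n → ℝ) : Prop :=
  graph f ∈ O.sets (n + 1)

/-- A set is tame if each intersection with a box `[-r, r]ⁿ` is definable in some o-minimal
structure, which may depend on `r`. -/
def IsTame {n : ℕ} (A : Set (Fin n → ℝ)) : Prop :=
  ∀ r : ℝ, 0 < r → ∃ O : OMinimalStructure, A ∩ {x | ∀ i, x i ∈ Set.Icc (-r) r} ∈ O.sets n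

/-- A function is tame if its graph is. -/
def IsTameFun {n : ℕ} (f : E n → ℝ) : Prop := IsTame (graph f)

/-- `f` is Lipschitz on some neighbourhood of `x`. -/
def LocallyLipschitzAround {n : ℕ} (f : E n → ℝ) (x : E n) : Prop :=
  ∃ K : ℝ≥0, ∃ U ∈ 𝓝 x, LipschitzOnWith K f U

/-- The Dini directional derivative `f'(x; l)`, the limit of `(f (x + t l) - f x) / t` as `t ↓ 0`,
exists (as a real number) and equals `d`. -/
def HasDirDeriv {n : ℕ} (f : E n → ℝ) (x l : E n) (d : ℝ) : Prop :=
  Tendsto (fun t : ℝ => (f (x + t • l) - f x) / t) (𝓝[>] 0) (𝓝 d)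

/-- A fixed choice, for every dimension `n + 2 ≥ 2` and every unit vector `l`, of a rotation that
maps `l` to the last standard basis vector (and hence `l^⊥` to the span of the other ones).
The values at vectors that are not unit vectors play no role. -/
structure RotationFamily where
  rot : (n : ℕ) → E (n + 2) → (E (n + 2) ≃ₗᵢ[ℝ] E (n + 2))
  det_rot : ∀ n (l : E (n + 2)), ‖l‖ = 1 →
    LinearMap.det ((rot n l).toLinearEquiv : E (n + 2) →ₗ[ℝ] E (n + 2)) = 1
  rot_self : ∀ n (l : E (n + 2)), ‖l‖ = 1 →
    rot n l l = EuclideanSpace.single (Fin.last (n + 1)) 1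

/-- The map `Πᵀ : ℝⁿ⁺¹ → l^⊥ ⊆ ℝⁿ⁺²`: append a zero last coordinate, then apply the inverse of
the rotation of `l`. -/
noncomputable def RotationFamily.piT (R : RotationFamily) {n : ℕ} (l : E (n + 2))
    (y : E (n + 1)) : E (n + 2) :=
  (R.rot n l).symm (WithLp.toLp 2 (Fin.snoc (α := fun _ => ℝ) (fun i => y i) 0))

/-- `f : ℝⁿ⁺¹ → ℝ` is `M`-directed subdifferentiable at `x`; recursion on the dimension. In the
recursive step `h` is the directional derivative `f'(x; ·)` (unique, being a limit), and
`y ↦ h (l + Πᵀ y)` is its restriction `f_l` to `l + l^⊥`. -/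
def MDirectedSubdifferentiableAt (R : RotationFamily) (M : ℝ) :
    (n : ℕ) → (E (n + 1) → ℝ) → E (n + 1) → Prop
  | 0, f, x => ∃ a b : ℝ,
      HasDirDeriv f x (-EuclideanSpace.single 0 1) a ∧
      HasDirDeriv f x (EuclideanSpace.single 0 1) b ∧ max |a| |b| ≤ M
  | n + 1, f, x => ∃ h : E (n + 2) → ℝ,
      (∀ l, HasDirDeriv f x l (h l)) ∧ Continuous h ∧ (∀ l, ‖l‖ = 1 → |h l| ≤ M) ∧
      ∀ l, ‖l‖ = 1 → MDirectedSubdifferentiableAt R M n (fun y => h (l + R.piT l y)) 0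

end DirSub

/-! On a ray from `x` the difference quotient of `f` is bounded, by the Lipschitz condition. For
each `c` the set of `t` where it exceeds `c` agrees for `t > 0` with a definable subset of the line,
a finite union of intervals, so it contains or misses a right neighbourhood of `0`. Hence limsup and
liminf agree (`exists_tendsto_of_forall_eventually_or`).

The function `f'(x; ·)` inherits the constant `K` from the quotients, and it is definable because
its ε-δ description is a first-order formula. Restriction to `l + l^⊥` composes it with an affine
isometry, which preserves both properties, so induction on the dimension gives `M = K`, independent
of `x` and the rotations. A tame `f` agrees near `x` with a definable function, and only the germ at
`x` matters. -/

namespace DirSub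

/-! ### Polynomial functions -/

/-- `g : ℝᵐ → ℝ` is given by a polynomial. -/
def IsPolyFun {m : ℕ} (g : (Fin m → ℝ) → ℝ) : Prop :=
  ∃ p : MvPolynomial (Fin m) ℝ, ∀ x, MvPolynomial.eval x p = g x

namespace IsPolyFun

variable {m : ℕ} {g k : (Fin m → ℝ) → ℝ}

theorem const (c : ℝ) : IsPolyFun (fun _ : Fin m → ℝ => c) := ⟨.C c, by simp⟩

theorem coord (i : Fin m) : IsPolyFun (fun x : Fin m → ℝ => x i) := ⟨.X i, by simp⟩

theorem add (hg : IsPolyFun g) (hk : IsPolyFun k) : IsPolyFun (fun x => g x + k x) := by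
  obtain ⟨p, hp⟩ := hg
  obtain ⟨q, hq⟩ := hk
  exact ⟨p + q, by simp [hp, hq]⟩

theorem sub (hg : IsPolyFun g) (hk : IsPolyFun k) : IsPolyFun (fun x => g x - k x) := by
  obtain ⟨p, hp⟩ := hg
  obtain ⟨q, hq⟩ := hk
  exact ⟨p - q, by simp [hp, hq]⟩

theorem mul (hg : IsPolyFun g) (hk : IsPolyFun k) : IsPolyFun (fun x => g x * k x) := by
  obtain ⟨p, hp⟩ := hg
  obtain ⟨q, hq⟩ := hk
  exact ⟨p * q, by simp [hp, hq]⟩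

theorem sum {ι : Type*} (s : Finset ι) {g : ι → (Fin m → ℝ) → ℝ} (hg : ∀ i, IsPolyFun (g i)) :
    IsPolyFun (fun x => ∑ i ∈ s, g i x) := by
  choose p hp using hg
  exact ⟨∑ i ∈ s, p i, by simp [hp]⟩

theorem comp_coords {n : ℕ} (hg : IsPolyFun g) (σ : Fin m → Fin n) :
    IsPolyFun (fun x : Fin n → ℝ => g (fun i => x (σ i))) := by
  obtain ⟨p, hp⟩ := hg
  exact ⟨MvPolynomial.rename σ p, fun x => (MvPolynomial.eval_rename σ x p).trans (hp _)⟩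

/-- A linear map followed by a coordinate is a polynomial function. -/
theorem linear {n : ℕ} (L : E m →ₗ[ℝ] E n) (i : Fin n) :
    IsPolyFun (fun x : Fin m → ℝ => L (WithLp.toLp 2 x) i) := by
  have h : ∀ x : Fin m → ℝ, L (WithLp.toLp 2 x) i =
      ∑ j, x j * L (EuclideanSpace.single j 1) i := by
    intro x
    have hx : WithLp.toLp 2 x = ∑ j, x j • (EuclideanSpace.single j 1 : E m) := by
      ext k
      simp [Pi.single_apply]
    rw [hx, map_sum]
    simp
  rw [funext h]
  exact sum _ fun j => (coord j).mul (const _)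

end IsPolyFun

/-! ### Calculus of definable sets -/

namespace OMinimalStructure

variable (O : OMinimalStructure) {m n : ℕ}

theorem inter_mem {A B : Set (Fin n → ℝ)} (hA : A ∈ O.sets n) (hB : B ∈ O.sets n) :
    A ∩ B ∈ O.sets n := by
  have := O.compl_mem n _ (O.union_mem n _ _ (O.compl_mem n _ hA) (O.compl_mem n _ hB))
  rwa [Set.compl_union, compl_compl, compl_compl] at this

theorem univ_mem : (Set.univ : Set (Fin n → ℝ)) ∈ O.sets n := by
  simpa using O.compl_mem n _ (O.empty_mem n)

theorem iInter_mem {k : ℕ} (A : Fin k → Set (Fin n → ℝ)) (hA : ∀ i, A i ∈ O.sets n) :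
    (⋂ i, A i) ∈ O.sets n := by
  induction k with
  | zero => simpa using O.univ_mem
  | succ k ih =>
    have h : (⋂ i, A i) = A 0 ∩ ⋂ i : Fin k, A i.succ := by
      ext x
      simp [Fin.forall_fin_succ]
    rw [h]
    exact O.inter_mem (hA 0) (ih _ fun i => hA _)

theorem setOf_and {P Q : (Fin n → ℝ) → Prop} (hP : {x | P x} ∈ O.sets n)
    (hQ : {x | Q x} ∈ O.sets n) : {x | P x ∧ Q x} ∈ O.sets n :=
  O.inter_mem hP hQ

theorem setOf_not {P : (Fin n → ℝ) → Prop} (hP : {x | P x} ∈ O.sets n) :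
    {x | ¬ P x} ∈ O.sets n :=
  O.compl_mem n _ hP

theorem setOf_imp {P Q : (Fin n → ℝ) → Prop} (hP : {x | P x} ∈ O.sets n)
    (hQ : {x | Q x} ∈ O.sets n) : {x | P x → Q x} ∈ O.sets n := by
  simp only [imp_iff_not_or]
  exact O.union_mem n _ _ (O.compl_mem n _ hP) hQ

theorem setOf_exists {P : (Fin n → ℝ) → ℝ → Prop}
    (hP : {z : Fin (n + 1) → ℝ | P (fun i => z i.castSucc) (z (Fin.last n))} ∈ O.sets (n + 1)) :
    {x | ∃ t, P x t} ∈ O.sets n := by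
  convert O.proj_mem n _ hP using 1
  ext x
  constructor
  · rintro ⟨t, ht⟩
    exact ⟨Fin.snoc (α := fun _ => ℝ) x t, by simpa using ht, by simp⟩
  · rintro ⟨z, hz, rfl⟩
    exact ⟨_, hz⟩

theorem setOf_forall {P : (Fin n → ℝ) → ℝ → Prop}
    (hP : {z : Fin (n + 1) → ℝ | P (fun i => z i.castSucc) (z (Fin.last n))} ∈ O.sets (n + 1)) :
    {x | ∀ t, P x t} ∈ O.sets n := by
  have h := O.setOf_not (O.setOf_exists (P := fun x t => ¬ P x t) (O.setOf_not hP))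
  simpa only [not_exists, not_not] using h

theorem setOf_exists_append {k : ℕ} (A : Set (Fin (m + k) → ℝ)) (hA : A ∈ O.sets (m + k)) :
    {x : Fin m → ℝ | ∃ y : Fin k → ℝ, Fin.append x y ∈ A} ∈ O.sets m := by
  induction k with
  | zero =>
    suffices h : {x : Fin m → ℝ | ∃ y : Fin 0 → ℝ, Fin.append x y ∈ A} = A by
      rw [h]
      exact hA
    ext x
    constructor
    · rintro ⟨y, hy⟩
      rw [Subsingleton.elim y Fin.elim0] at hy
      simpa using hy
    · intro hx
      exact ⟨Fin.elim0, by simpa using hx⟩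
  | succ k ih =>
    convert ih _ (O.proj_mem (m + k) A hA) using 1
    ext x
    constructor
    · rintro ⟨y, hy⟩
      refine ⟨fun i => y i.castSucc, _, hy, ?_⟩
      funext i
      refine Fin.addCases (fun j => ?_) (fun j => ?_) i
      · exact (Fin.append_left x y j).trans (Fin.append_left x _ j).symm
      · exact (Fin.append_right x y j.castSucc).trans (Fin.append_right x (fun i => y i.castSucc) j).symm
    · rintro ⟨y, z, hz, hzy⟩
      refine ⟨Fin.snoc (α := fun _ => ℝ) y (z (Fin.last (m + k))), ?_⟩
      rw [Fin.append_snoc, ← hzy]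
      exact (Fin.snoc_init_self z).symm ▸ hz

theorem setOf_natAdd_mem {A : Set (Fin n → ℝ)} (hA : A ∈ O.sets n) :
    {z : Fin (m + n) → ℝ | (fun i : Fin n => z (Fin.natAdd m i)) ∈ A} ∈ O.sets (m + n) := by
  have key : {z : Fin (n + m) → ℝ | (fun i : Fin n => z (i.addNat m)) ∈ A} ∈ O.sets (n + m) := by
    induction m with
    | zero => exact hA
    | succ m ih => exact O.univ_prod_mem _ _ ih
  -- `key` lives in dimension `n + m`, and the goal in `m + n`.
  have cast : ∀ k (h : n + m = k), {z : Fin k → ℝ |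
      (fun i : Fin n => z (Fin.cast h (i.addNat m))) ∈ A} ∈ O.sets k := by
    rintro _ rfl
    exact key
  have h : ∀ i : Fin n, Fin.natAdd m i = Fin.cast (Nat.add_comm n m) (i.addNat m) := fun i =>
    Fin.ext (by simp)
  simp only [h]
  exact cast (m + n) (Nat.add_comm n m)

theorem setOf_eq {g k : (Fin n → ℝ) → ℝ} (hg : IsPolyFun g) (hk : IsPolyFun k) :
    {x | g x = k x} ∈ O.sets n := by
  obtain ⟨p, hp⟩ := hg.sub hk
  simpa only [hp, sub_eq_zero] using O.algebraic_mem n p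

/-- Order is algebraic up to a projection: `a > 0` iff `a * t ^ 2 = 1` has a solution. -/
theorem setOf_lt {g k : (Fin n → ℝ) → ℝ} (hg : IsPolyFun g) (hk : IsPolyFun k) :
    {x | g x < k x} ∈ O.sets n := by
  have h := O.setOf_exists (P := fun x t => (k x - g x) * (t * t) = 1) (O.setOf_eq
    (((hk.comp_coords _).sub (hg.comp_coords _)).mul ((IsPolyFun.coord _).mul (.coord _)))
    (.const 1))
  convert h using 3 with x
  constructor
  · intro hx
    have hx' : 0 < k x - g x := sub_pos.2 hx
    refine ⟨(√(k x - g x))⁻¹, ?_⟩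
    rw [← mul_inv, Real.mul_self_sqrt hx'.le, mul_inv_cancel₀ hx'.ne']
  · rintro ⟨t, ht⟩
    nlinarith [mul_self_nonneg t]

/-- Preimages of definable sets under polynomial maps are definable. -/
theorem setOf_polyFun_mem {A : Set (Fin n → ℝ)} (hA : A ∈ O.sets n)
    {g : Fin n → (Fin m → ℝ) → ℝ} (hg : ∀ i, IsPolyFun (g i)) :
    {x : Fin m → ℝ | (fun i => g i x) ∈ A} ∈ O.sets m := by
  -- The preimage is the projection of `{(x, y) | y ∈ A, y = g x}`.
  have h := O.setOf_exists_append _ (O.inter_mem (O.setOf_natAdd_mem (m := m) hA)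
    (O.iInter_mem _ fun i => O.setOf_eq (IsPolyFun.coord (Fin.natAdd m i))
      ((hg i).comp_coords (Fin.castAdd n))))
  convert h using 3 with x
  constructor
  · intro hx
    exact ⟨fun i => g i x, by simpa using hx, by simp⟩
  · rintro ⟨y, hy, hyg⟩
    have hy' : y = fun i => g i x := by
      funext i
      simpa using Set.mem_iInter.1 hyg i
    subst hy'
    simpa using hy

/-- Composition of a definable function with a polynomial map. -/
theorem DefinableFun.comp_polyFun {O : OMinimalStructure} {f : E n → ℝ} (hf : O.DefinableFun f)
    {G : E m → E n} (hG : ∀ i, IsPolyFun (fun x : Fin m → ℝ => G (WithLp.toLp 2 x) i)) :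
    O.DefinableFun (fun x => f (G x)) := by
  have h := O.setOf_polyFun_mem hf (g := Fin.lastCases (motive := fun _ => (Fin (m + 1) → ℝ) → ℝ)
    (fun z => z (Fin.last m))
    (fun i z => G (WithLp.toLp 2 fun j : Fin m => z j.castSucc) i)) (by
      intro i
      refine Fin.lastCases ?_ (fun i => ?_) i
      · simpa using IsPolyFun.coord (Fin.last m)
      · simpa using (hG i).comp_coords Fin.castSucc)
  rw [OMinimalStructure.DefinableFun]
  convert h using 1
  ext z
  simp [graph]

/-- A definable subset of the line either contains or misses a right neighbourhood of `0`. -/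
theorem eventually_or_eventually_not {P : ℝ → Prop} (hP : {x : Fin 1 → ℝ | P (x 0)} ∈ O.sets 1) :
    (∀ᶠ t in 𝓝[>] (0 : ℝ), P t) ∨ ∀ᶠ t in 𝓝[>] (0 : ℝ), ¬ P t := by
  obtain ⟨S, hS, hI, hPS⟩ := (O.mem_one_iff _).1 hP
  have hP' : ∀ t, P t ↔ ∃ I ∈ S, t ∈ I := by
    intro t
    have := Set.ext_iff.1 hPS (fun _ => t)
    simpa using this
  by_cases h : ∃ I ∈ S, ∃ᶠ t in 𝓝[>] (0 : ℝ), t ∈ I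
  · obtain ⟨I, hIS, hfr⟩ := h
    left
    -- An interval with points arbitrarily close to `0` on the right contains all of `(0, b)` once
    -- it contains `b > 0`.
    obtain ⟨b, hbI, hb⟩ := (hfr.and_eventually self_mem_nhdsWithin).exists
    filter_upwards [Ioo_mem_nhdsGT hb] with t ht
    obtain ⟨a, haI, ha⟩ := (hfr.and_eventually (Ioo_mem_nhdsGT ht.1)).exists
    exact (hP' t).2 ⟨I, hIS, (hI I hIS).out haI hbI ⟨ha.2.le, ht.2.le⟩⟩
  · right
    push Not at h
    have h' : ∀ᶠ t in 𝓝[>] (0 : ℝ), ∀ I ∈ S, t ∉ I :=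
      (Filter.eventually_all_finite hS).2 h
    filter_upwards [h'] with t ht hPt
    obtain ⟨I, hIS, htI⟩ := (hP' t).1 hPt
    exact ht I hIS htI

end OMinimalStructure

/-! ### Directional derivatives -/

/-- `f` is `K`-Lipschitz near `x`. -/
def LipschitzNear {n : ℕ} (K : ℝ≥0) (f : E n → ℝ) (x : E n) : Prop :=
  ∃ U ∈ 𝓝 x, LipschitzOnWith K f U

theorem HasDirDeriv.unique {n : ℕ} {f : E n → ℝ} {x l : E n} {a b : ℝ}
    (ha : HasDirDeriv f x l a) (hb : HasDirDeriv f x l b) : a = b :=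
  tendsto_nhds_unique ha hb

theorem tendsto_add_smul {n : ℕ} (x l : E n) :
    Tendsto (fun t : ℝ => x + t • l) (𝓝[>] 0) (𝓝 x) := by
  have h : Continuous fun t : ℝ => x + t • l := by fun_prop
  have := h.tendsto 0
  simp only [zero_smul, add_zero] at this
  exact this.mono_left nhdsWithin_le_nhds

theorem HasDirDeriv.congr {n : ℕ} {f g : E n → ℝ} {x l : E n} {d : ℝ}
    (h : HasDirDeriv f x l d) (hfg : f =ᶠ[𝓝 x] g) : HasDirDeriv g x l d := by
  refine Tendsto.congr' ?_ h
  filter_upwards [(tendsto_add_smul x l).eventually hfg] with t ht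
  rw [ht, hfg.self_of_nhds]

/-- Serves twice: `l' = 0` bounds the quotients, and general `l'` gives the Lipschitz constant of
the limit. -/
theorem LipschitzNear.eventually_quotient {n : ℕ} {K : ℝ≥0} {f : E n → ℝ} {x : E n}
    (hf : LipschitzNear K f x) (l l' : E n) : ∀ᶠ t in 𝓝[>] (0 : ℝ),
      |(f (x + t • l) - f x) / t - (f (x + t • l') - f x) / t| ≤ K * ‖l - l'‖ := by
  obtain ⟨U, hU, hL⟩ := hf
  filter_upwards [(tendsto_add_smul x l).eventually hU, (tendsto_add_smul x l').eventually hU,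
    self_mem_nhdsWithin] with t h1 h2 (ht : 0 < t)
  have h := hL.dist_le_mul _ h1 _ h2
  rw [dist_add_left, dist_eq_norm, dist_eq_norm, ← smul_sub, norm_smul, Real.norm_eq_abs,
    Real.norm_eq_abs, abs_of_pos ht] at h
  rw [← sub_div, sub_sub_sub_cancel_right, abs_div, abs_of_pos ht, div_le_iff₀ ht]
  linarith

theorem lipschitzWith_dirDeriv {n : ℕ} {K : ℝ≥0} {f : E n → ℝ} {x : E n}
    (hf : LipschitzNear K f x) {h : E n → ℝ} (hh : ∀ l, HasDirDeriv f x l (h l)) :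
    LipschitzWith K h := by
  refine LipschitzWith.of_dist_le_mul fun l l' => ?_
  rw [dist_eq_norm, dist_eq_norm, Real.norm_eq_abs]
  exact le_of_tendsto ((hh l).sub (hh l')).abs (hf.eventually_quotient l l')

theorem abs_dirDeriv_le {n : ℕ} {K : ℝ≥0} {f : E n → ℝ} {x l : E n} {d : ℝ}
    (hf : LipschitzNear K f x) (hd : HasDirDeriv f x l d) : |d| ≤ K * ‖l‖ := by
  refine le_of_tendsto hd.abs ?_
  simpa using hf.eventually_quotient l 0

/-- A bounded function on a right neighbourhood of `0` whose superlevel sets eventually contain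
or miss the points `t ↓ 0` has a limit. -/
theorem exists_tendsto_of_forall_eventually_or {ι : Type*} {F : Filter ι} [F.NeBot] {q : ι → ℝ}
    {B : ℝ} (hB : ∀ᶠ t in F, |q t| ≤ B)
    (h : ∀ c, (∀ᶠ t in F, c < q t) ∨ ∀ᶠ t in F, ¬ c < q t) : ∃ d, Tendsto q F (𝓝 d) := by
  have hle : F.IsBoundedUnder (· ≤ ·) q :=
    ⟨B, eventually_map.2 (hB.mono fun t ht => (abs_le.1 ht).2)⟩
  have hge : F.IsBoundedUnder (· ≥ ·) q :=
    ⟨-B, eventually_map.2 (hB.mono fun t ht => (abs_le.1 ht).1)⟩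
  refine ⟨limsup q F, tendsto_of_le_liminf_of_limsup_le ?_ le_rfl hle hge⟩
  refine le_of_forall_lt fun c hc => ?_
  obtain ⟨c', hcc', hc'⟩ := exists_between hc
  rcases h c' with h | h
  · exact hcc'.trans_le (le_liminf_of_le hle.isCoboundedUnder_ge (h.mono fun _ => le_of_lt))
  · exact absurd (limsup_le_of_le hge.isCoboundedUnder_le (h.mono fun _ => not_lt.1)) hc'.not_ge

theorem OMinimalStructure.DefinableFun.exists_hasDirDeriv {n : ℕ} {O : OMinimalStructure}
    {f : E n → ℝ} {x : E n} {K : ℝ≥0} (hf : LipschitzNear K f x) (hO : O.DefinableFun f)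
    (l : E n) : ∃ d, HasDirDeriv f x l d := by
  refine exists_tendsto_of_forall_eventually_or (B := K * ‖l‖)
    (by simpa using hf.eventually_quotient l 0) fun c => ?_
  have hdef : {y : Fin 1 → ℝ | c * y 0 < f (x + y 0 • l) - f x} ∈ O.sets 1 := by
    have hG : O.DefinableFun (fun y : E 1 => f (x + y 0 • l)) := by
      refine hO.comp_polyFun (G := fun y : E 1 => x + y 0 • l) fun i => ?_
      simpa using (IsPolyFun.const (x i)).add ((IsPolyFun.coord 0).mul (.const (l i)))
    -- The value of `f` enters as a quantified `s` tied to the graph, leaving a polynomial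
    -- inequality.
    have := O.setOf_exists (P := fun y s => f (x + y 0 • l) = s ∧ c * y 0 < s - f x)
      (O.setOf_and hG (O.setOf_lt ((IsPolyFun.const c).mul (.coord _))
        ((IsPolyFun.coord _).sub (.const _))))
    simpa using this
  have hiff : ∀ᶠ t in 𝓝[>] (0 : ℝ),
      (c < (f (x + t • l) - f x) / t ↔ c * t < f (x + t • l) - f x) := by
    filter_upwards [self_mem_nhdsWithin] with t (ht : 0 < t)
    exact lt_div_iff₀ ht
  rw [eventually_congr hiff, eventually_congr (hiff.mono fun _ h => not_congr h)]
  exact O.eventually_or_eventually_not hdef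

/-- Division is cleared and `f (x + t • l)` is named `s`, so that every atom is a polynomial
inequality or membership in the graph of `f`. -/
theorem hasDirDeriv_iff {n : ℕ} {f : E n → ℝ} {x l : E n} {d : ℝ} : HasDirDeriv f x l d ↔
    ∀ ε, 0 < ε → ∃ δ, 0 < δ ∧ ∀ t, (0 < t ∧ t < δ) → ∀ s, f (x + t • l) = s →
      (s - f x < (d + ε) * t ∧ (d - ε) * t < s - f x) := by
  rw [HasDirDeriv, Metric.tendsto_nhds]
  refine forall₂_congr fun ε _ => ?_
  rw [(nhdsGT_basis (0 : ℝ)).eventually_iff]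
  refine exists_congr fun δ => and_congr_right fun _ => forall₂_congr fun t ht => ?_
  rw [forall_eq', Real.dist_eq, abs_lt, ← div_lt_iff₀ ht.1, ← lt_div_iff₀ ht.1]
  constructor <;> rintro ⟨h1, h2⟩ <;> constructor <;> linarith

theorem OMinimalStructure.DefinableFun.definableFun_dirDeriv {n : ℕ} {O : OMinimalStructure}
    {f : E n → ℝ} {x : E n} (hO : O.DefinableFun f) {h : E n → ℝ}
    (hh : ∀ l, HasDirDeriv f x l (h l)) : O.DefinableFun h := by
  have hgr : graph h = {z : Fin (n + 1) → ℝ |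
      HasDirDeriv f x (WithLp.toLp 2 fun i : Fin n => z i.castSucc) (z (Fin.last n))} := by
    ext z
    refine ⟨fun hz => ?_, fun hz => (hh _).unique hz⟩
    rw [Set.mem_ofPred_eq, ← show h _ = _ from hz]
    exact hh _
  rw [OMinimalStructure.DefinableFun, hgr]
  simp only [hasDirDeriv_iff]
  refine O.setOf_forall (O.setOf_imp (O.setOf_lt (.const _) (.coord _)) (O.setOf_exists
    (O.setOf_and (O.setOf_lt (.const _) (.coord _)) (O.setOf_forall (O.setOf_imp
      (O.setOf_and (O.setOf_lt (.const _) (.coord _)) (O.setOf_lt (.coord _) (.coord _)))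
      (O.setOf_forall (O.setOf_imp ?_ (O.setOf_and
        (O.setOf_lt ((IsPolyFun.coord _).sub (.const _))
          (((IsPolyFun.coord _).add (.coord _)).mul (.coord _)))
        (O.setOf_lt (((IsPolyFun.coord _).sub (.coord _)).mul (.coord _))
          ((IsPolyFun.coord _).sub (.const _)))))))))))
  -- The variables are `(l, d, ε, δ, t)`, with `s` as the graph coordinate.
  refine hO.comp_polyFun (m := n + 1 + 1 + 1 + 1)
    (G := fun y => x + y (Fin.last _) •
      WithLp.toLp 2 fun i : Fin n => y i.castSucc.castSucc.castSucc.castSucc) fun i => ?_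
  exact (IsPolyFun.const (x i)).add ((IsPolyFun.coord _).mul (.coord _))

/-! ### Directed subdifferentiability -/

theorem RotationFamily.norm_piT_sub {R : RotationFamily} {n : ℕ} (l : E (n + 2))
    (y y' : E (n + 1)) : ‖R.piT l y - R.piT l y'‖ = ‖y - y'‖ := by
  rw [piT, piT, ← map_sub, LinearIsometryEquiv.norm_map, EuclideanSpace.norm_eq,
    EuclideanSpace.norm_eq, Fin.sum_univ_castSucc]
  simp

theorem RotationFamily.isPolyFun_piT (R : RotationFamily) {n : ℕ} (l : E (n + 2))
    (i : Fin (n + 2)) : IsPolyFun fun y : Fin (n + 1) → ℝ => R.piT l (WithLp.toLp 2 y) i := by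
  let L : E (n + 1) →ₗ[ℝ] E (n + 2) :=
    { toFun := fun y => WithLp.toLp 2 (Fin.snoc (α := fun _ => ℝ) (fun i => y i) 0)
      map_add' := fun y y' => by
        ext j
        refine Fin.lastCases ?_ (fun j => ?_) j <;> simp
      map_smul' := fun c y => by
        ext j
        refine Fin.lastCases ?_ (fun j => ?_) j <;> simp }
  exact IsPolyFun.linear
    (((R.rot n l).symm.toLinearEquiv : E (n + 2) →ₗ[ℝ] E (n + 2)) ∘ₗ L) i

theorem MDirectedSubdifferentiableAt.congr {R : RotationFamily} {M : ℝ} {n : ℕ}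
    {f g : E (n + 1) → ℝ} {x : E (n + 1)} (hf : MDirectedSubdifferentiableAt R M n f x)
    (hfg : f =ᶠ[𝓝 x] g) : MDirectedSubdifferentiableAt R M n g x := by
  cases n with
  | zero =>
    obtain ⟨a, b, ha, hb, hab⟩ := hf
    exact ⟨a, b, ha.congr hfg, hb.congr hfg, hab⟩
  | succ n =>
    obtain ⟨h, hh, hrest⟩ := hf
    exact ⟨h, fun l => (hh l).congr hfg, hrest⟩

theorem OMinimalStructure.DefinableFun.mDirectedSubdifferentiableAt {O : OMinimalStructure}
    (R : RotationFamily) {K : ℝ≥0} {n : ℕ} {f : E (n + 1) → ℝ} {x : E (n + 1)}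
    (hO : O.DefinableFun f) (hf : LipschitzNear K f x) :
    MDirectedSubdifferentiableAt R K n f x := by
  induction n with
  | zero =>
    obtain ⟨a, ha⟩ := hO.exists_hasDirDeriv hf (-EuclideanSpace.single 0 1)
    obtain ⟨b, hb⟩ := hO.exists_hasDirDeriv hf (EuclideanSpace.single 0 1)
    exact ⟨a, b, ha, hb, max_le (by simpa using abs_dirDeriv_le hf ha)
      (by simpa using abs_dirDeriv_le hf hb)⟩
  | succ n ih =>
    choose h hh using hO.exists_hasDirDeriv hf
    have hL := lipschitzWith_dirDeriv hf hh
    refine ⟨h, hh, hL.continuous, fun l hl => by simpa [hl] using abs_dirDeriv_le hf (hh l),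
      fun l _ => ih ?_ ⟨Set.univ, Filter.univ_mem, ?_⟩⟩
    · exact (hO.definableFun_dirDeriv hh).comp_polyFun fun i =>
        (IsPolyFun.const (l i)).add (R.isPolyFun_piT l i)
    · refine (LipschitzWith.of_dist_le_mul fun y y' => ?_).lipschitzOnWith
      refine (hL.dist_le_mul _ _).trans_eq ?_
      rw [dist_add_left, dist_eq_norm, dist_eq_norm, R.norm_piT_sub]

/-- Near a point of continuity, a tame function coincides with a definable one. -/
theorem IsTameFun.exists_definableFun_eventuallyEq {n : ℕ} {f : E n → ℝ} (hf : IsTameFun f)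
    {x : E n} (hx : ContinuousAt f x) :
    ∃ (O : OMinimalStructure) (g : E n → ℝ), O.DefinableFun g ∧ g =ᶠ[𝓝 x] f := by
  classical
  -- The `+ 1` puts `(x, f x)` in the interior of the box, so by continuity the graph near `x` stays
  -- inside.
  set r : ℝ := max ‖x‖ |f x| + 1
  have hr : 0 < r := by positivity
  obtain ⟨O, hO⟩ := hf r hr
  set B := graph f ∩ {z | ∀ i, z i ∈ Set.Icc (-r) r}
  let A : Set (Fin n → ℝ) := (fun (z : Fin (n + 1) → ℝ) (i : Fin n) => z i.castSucc) '' B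
  have hA : A ∈ O.sets n := O.proj_mem n B hO
  refine ⟨O, fun y => if WithLp.ofLp y ∈ A then f y else 0, ?_, ?_⟩
  -- The graph of the extension by `0` is `B ∪ (Aᶜ × {0})`.
  · have := O.union_mem _ _ _ hO (O.inter_mem
      (O.compl_mem _ _ (O.prod_univ_mem n A hA))
      (O.setOf_eq (IsPolyFun.coord (Fin.last n)) (.const 0)))
    rw [OMinimalStructure.DefinableFun]
    convert this using 1
    ext z
    by_cases hz : (fun i : Fin n => z i.castSucc) ∈ A
    -- Over a point of `A` the graph of `f` has a single point, which is the one in `B`.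
    · have hzB : z ∈ graph f → z ∈ B := by
        intro hzf
        obtain ⟨w, hw, hwz⟩ := hz
        have : w = z := by
          have h1 : f _ = _ := hw.1
          have h2 : f _ = _ := hzf
          funext i
          refine Fin.lastCases ?_ (fun i => congrFun hwz i) i
          rw [← h1, ← h2]
          exact congrArg (fun v => f (WithLp.toLp 2 v)) hwz
        exact this ▸ hw
      have : z ∈ graph f ↔ z ∈ B := ⟨hzB, fun h => h.1⟩
      simp only [graph, Set.mem_ofPred_eq] at this ⊢
      simp [hz, this]
    · have hzB : z ∉ B := fun h => hz ⟨z, h, rfl⟩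
      simp [graph, hz, hzB, eq_comm]
  · have h1 : ∀ᶠ y in 𝓝 x, ‖y‖ < r :=
      continuous_norm.continuousAt.eventually_lt continuousAt_const
        (lt_of_le_of_lt (le_max_left _ _) (lt_add_one _))
    have h2 : ∀ᶠ y in 𝓝 x, |f y| < r :=
      hx.abs.eventually_lt continuousAt_const
        (lt_of_le_of_lt (le_max_right _ _) (lt_add_one _))
    filter_upwards [h1, h2] with y hy hfy
    refine if_pos ⟨Fin.snoc (α := fun _ => ℝ) (WithLp.ofLp y) (f y), ⟨?_, fun i => ?_⟩, by simp⟩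
    · simp [graph]
    · refine abs_le.1 ?_
      refine Fin.lastCases ?_ (fun i => ?_) i
      · simpa using hfy.le
      · simpa using (PiLp.norm_apply_le y i).trans hy.le

theorem mDirectedSubdifferentiableAt_of_lipschitzNear (R : RotationFamily) {n : ℕ}
    {f : E (n + 1) → ℝ} {x : E (n + 1)} {K : ℝ≥0}
    (hf : (∃ O : OMinimalStructure, O.DefinableFun f) ∨ IsTameFun f) (hL : LipschitzNear K f x) :
    MDirectedSubdifferentiableAt R K n f x := by
  obtain ⟨O, hO⟩ | hf := hf
  · exact hO.mDirectedSubdifferentiableAt R hL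
  · obtain ⟨U, hU, hLU⟩ := hL
    obtain ⟨O, g, hg, hgf⟩ :=
      hf.exists_definableFun_eventuallyEq (hLU.continuousOn.continuousAt hU)
    refine (hg.mDirectedSubdifferentiableAt R (K := K) ⟨_, inter_mem hU hgf, ?_⟩).congr hgf
    intro y hy y' hy'
    rw [show g y = f y from hy.2, show g y' = f y' from hy'.2]
    exact hLU hy.1 hy'.1

end DirSub

theorem mainTheorem5 :
    -- the directional derivative exists, is globally Lipschitz, and is definable
    (∀ (n : ℕ) (O : DirSub.OMinimalStructure) (f : DirSub.E n → ℝ) (x : DirSub.E n),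
      DirSub.LocallyLipschitzAround f x → O.DefinableFun f →
      ∃ h : DirSub.E n → ℝ, (∀ l, DirSub.HasDirDeriv f x l (h l)) ∧
        (∃ K : ℝ≥0, LipschitzWith K h) ∧ O.DefinableFun h) ∧
    -- directed subdifferentiability at a point around which `f` is Lipschitz
    (∀ (R : DirSub.RotationFamily) (n : ℕ) (f : DirSub.E (n + 1) → ℝ) (x : DirSub.E (n + 1)),
      ((∃ O : DirSub.OMinimalStructure, O.DefinableFun f) ∨ DirSub.IsTameFun f) →
      DirSub.LocallyLipschitzAround f x →
      ∃ M : ℝ, 0 ≤ M ∧ DirSub.MDirectedSubdifferentiableAt R M n f x) ∧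
    -- for a globally Lipschitz `f`, one constant serves all points
    (∀ (R : DirSub.RotationFamily) (n : ℕ) (f : DirSub.E (n + 1) → ℝ),
      ((∃ O : DirSub.OMinimalStructure, O.DefinableFun f) ∨ DirSub.IsTameFun f) →
      (∃ K : ℝ≥0, LipschitzWith K f) →
      ∃ M : ℝ, 0 ≤ M ∧ ∀ x, DirSub.MDirectedSubdifferentiableAt R M n f x) := by
  refine ⟨?_, ?_, ?_⟩
  · rintro n O f x ⟨K, hL⟩ hO
    choose h hh using hO.exists_hasDirDeriv hL
    exact ⟨h, hh, ⟨K, DirSub.lipschitzWith_dirDeriv hL hh⟩, hO.definableFun_dirDeriv hh⟩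
  · rintro R n f x hf ⟨K, hL⟩
    exact ⟨K, K.2, DirSub.mDirectedSubdifferentiableAt_of_lipschitzNear R hf hL⟩
  · rintro R n f hf ⟨K, hL⟩
    exact ⟨K, K.2, fun x => DirSub.mDirectedSubdifferentiableAt_of_lipschitzNear R hf
      ⟨Set.univ, Filter.univ_mem, hL.lipschitzOnWith⟩⟩
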